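/- Let $P$ be a poset, regarded as a category with a unique morphism $p\to q$ whenever $p\le q$. Let $X$ be the dcpo of filters on $P$ (nonempty, down-directed, upward closed subsets of $P$, ordered by inclusion), with the Scott topology, and identify $p\in P$ with the principal filter $\{q : p\le q\}\in X$. Then the presheaf topos $\mathsf{PSh}(P)$ is a coherent topos if and only if $X$ is a spectral space. Assume that this is the case, and let $S\subseteq X$ be a sober subspace. Then the following four conditions are equivalent: (a) $S$ is a patch in $X$, i.e. it is closed in the topology on $X$ that has as subbasis the compact open subsets of $X$ and their complements; (b) $S$ is a spectral subobject of $X$, i.e. $S$ with the subspace topology is a spectral space and $U\cap S$ is compact for every compact open $U\subseteq X$; (c) the Grothendieck topology $K_S$ on $P$ is of finite type, where a sieve $L$ on $p$ is $K_S$-covering if and only if every $x\in S$ with $p\le x$ in $X$ satisfies $q\le x$ in $X$ for some $q\in L$, and where a Grothendieck topology is of finite type if every covering sieve contains a finitely generated covering sieve; (d) $\mathsf{Sh}(S)\subseteq\mathsf{Sh}(X)$ is a coherent subtopos, i.e. the geometric morphism $\mathsf{Sh}(S)\to\mathsf{Sh}(X)$ induced by the inclusion is an inclusion of toposes, both toposes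 are coherent, and its inverse image functor preserves coherent objects. Here a spectral space is a sober compact space whose compact open sets are closed under binary intersection and form a basis. An object $E$ of a topos is compact if every epimorphic family with codomain $E$ contains a finite epimorphic subfamily; it is coherent if it is compact and $E'\times_E E''$ is compact for all morphisms $E'\to E\leftarrow E''$ with $E',E''$ compact. A coherent topos is a Grothendieck topos with a full subcategory of compact objects that generates it and is closed under finite limits. -/

import Mathlib

universe u v v' w w'

open CategoryTheory CategoryTheory.Limits Topology

section Topos

variable {C : Type w} [Category.{v} C]

/-- A family of morphisms with common codomain is epimorphic if two morphisms out of the codomain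
that agree after composition with every member of the family are equal. -/
def IsEpimorphicFamily {E : C} {ι : Type w'} (D : ι → C) (f : ∀ i, D i ⟶ E) : Prop :=
  ∀ ⦃Z : C⦄ (g h : E ⟶ Z), (∀ i, f i ≫ g = f i ≫ h) → g = h

/-- An object is compact if every epimorphic family with this codomain contains a finite
epimorphic subfamily. The universe of the index type is large enough for the family of all
morphisms into `E`. -/
def IsCompactObj (E : C) : Prop :=
  ∀ ⦃ι : Type (max v w)⦄ (D : ι → C) (f : ∀ i, D i ⟶ E), IsEpimorphicFamily D f →
    ∃ s : Finset ι, IsEpimorphicFamily (fun i : s => D i) (fun i : s => f i)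

/-- An object `E` is coherent if it is compact and every pullback of compact objects over `E`
is compact. -/
structure IsCoherentObj (E : C) : Prop where
  isCompactObj : IsCompactObj E
  isCompactObj_pullback : ∀ ⦃E₁ E₂ T : C⦄ (p₁ : T ⟶ E₁) (p₂ : T ⟶ E₂) (f₁ : E₁ ⟶ E) (f₂ : E₂ ⟶ E),
    IsPullback p₁ p₂ f₁ f₂ → IsCompactObj E₁ → IsCompactObj E₂ → IsCompactObj T

/-- A (Grothendieck) topos: a category equivalent to the category of sheaves on a small site. -/
def IsGrothendieckTopos (E : Type (u + 1)) [Category.{u} E] : Prop :=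
  ∃ (D : Type u) (_ : SmallCategory D) (J : GrothendieckTopology D),
    Nonempty (E ≌ Sheaf J (Type u))

/-- A coherent topos: a topos containing a full subcategory of compact generators that is closed
under finite limits. -/
structure IsCoherentTopos (E : Type (u + 1)) [Category.{u} E] : Prop where
  isTopos : IsGrothendieckTopos E
  exists_generators : ∃ K : ObjectProperty E, (∀ A, K A → IsCompactObj A) ∧ K.IsSeparating ∧
    ∀ (J : Type) [SmallCategory J] [FinCategory J], K.IsClosedUnderLimitsOfShape J

/-- A geometric morphism from `E` to `F`. -/
structure GeomMorphism (E : Type w) [Category.{v} E] (F : Type w') [Category.{v'} F] where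
  direct : E ⥤ F
  inverse : F ⥤ E
  adj : inverse ⊣ direct
  preservesFiniteLimits : PreservesFiniteLimits inverse

/-- A geometric morphism is an inclusion (it exhibits its source as a subtopos of its target) if
its direct image functor is fully faithful. -/
def GeomMorphism.IsInclusion {E : Type w} [Category.{v} E] {F : Type w'} [Category.{v'} F]
    (f : GeomMorphism E F) : Prop :=
  f.direct.Full ∧ f.direct.Faithful

/-- A coherent geometric morphism: a geometric morphism between coherent toposes whose inverse
image functor preserves coherent objects. -/
structure GeomMorphism.IsCoherent {E F : Type (u + 1)} [Category.{u} E] [Category.{u} F]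
    (f : GeomMorphism E F) : Prop where
  source : IsCoherentTopos E
  target : IsCoherentTopos F
  map_coherent : ∀ A : F, IsCoherentObj A → IsCoherentObj (f.inverse.obj A)

/-- The subtopos given by `f` is a coherent subtopos: `f` is an inclusion and is coherent
(in particular its source is a coherent topos). -/
def GeomMorphism.IsCoherentSubtopos {E F : Type (u + 1)} [Category.{u} E] [Category.{u} F]
    (f : GeomMorphism E F) : Prop :=
  f.IsInclusion ∧ f.IsCoherent

/-- The category `Sh(X)` of sheaves of sets on a topological space. -/
abbrev ShTop (X : Type u) [TopologicalSpace X] : Type (u + 1) :=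
  TopCat.Sheaf (Type u) (TopCat.of X)

/-- The geometric morphism `Sh(X) ⟶ Sh(Y)` induced by a continuous map. -/
noncomputable def GeomMorphism.ofTopCatHom {X Y : TopCat.{u}} (f : X ⟶ Y) :
    GeomMorphism (TopCat.Sheaf (Type u) X) (TopCat.Sheaf (Type u) Y) where
  direct := TopCat.Sheaf.pushforward (Type u) f
  inverse := TopCat.Sheaf.pullback (Type u) f
  adj := TopCat.Sheaf.pullbackPushforwardAdjunction (Type u) f
  preservesFiniteLimits := by
    unfold TopCat.Sheaf.pullback
    apply Functor.SmallCategories.instPreservesFiniteLimitsSheafSheafPullbackOfRepresentablyFlat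

/-- The geometric morphism `Sh(S) ⟶ Sh(X)` induced by the inclusion of a subspace. -/
noncomputable def GeomMorphism.ofSubspace {X : Type u} [TopologicalSpace X] (S : Set X) :
    GeomMorphism (ShTop S) (ShTop X) :=
  GeomMorphism.ofTopCatHom (TopCat.ofHom ⟨Subtype.val, continuous_subtype_val⟩)

/-- A Grothendieck topology is of finite type if every covering sieve contains a finitely
generated covering sieve. -/
def CategoryTheory.GrothendieckTopology.IsOfFiniteType (J : GrothendieckTopology C) : Prop :=
  ∀ ⦃X : C⦄ (L : Sieve X), L ∈ J X → ∃ (n : ℕ) (Y : Fin n → C) (f : ∀ i, Y i ⟶ X),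
    Sieve.ofArrows Y f ∈ J X ∧ Sieve.ofArrows Y f ≤ L

end Topos

section Spaces

variable {X : Type u} [TopologicalSpace X]

/-- A patch: a closed set for the patch topology, which has as subbasis the compact opens and
their complements. -/
def IsPatch (S : Set X) : Prop :=
  IsClosed[constructibleTopology X] S

/-- A spectral subobject: a subspace that is a spectral space and whose inclusion is a spectral
map. -/
def IsSpectralSubobject (S : Set X) : Prop :=
  SpectralSpace S ∧ IsSpectralMap (Subtype.val : S → X)

/-- A subspace is sober if each irreducible closed subset has a unique generic point. -/
def IsSoberSubspace (S : Set X) : Prop :=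
  T0Space S ∧ QuasiSober S

end Spaces

section Filters

variable {P : Type u} [PartialOrder P]

/-- The dcpo of filters on `P`, ordered by inclusion, carries the Scott topology. -/
instance Order.PFilter.instTopologicalSpaceScott : TopologicalSpace (Order.PFilter P) :=
  Topology.scott (Order.PFilter P) Set.univ

/-- The upward closure in the dcpo of filters of a sieve `L`, where elements of `P` are
identified with principal filters. -/
def sieveTilde {p : P} (L : Sieve p) : Set (Order.PFilter P) :=
  {x | ∃ (q : P) (f : q ⟶ p), L f ∧ Order.PFilter.principal q ≤ x}

/-- The Grothendieck topology `K_S` on `P` of a set `S` of filters: a sieve `L` on `p` is covering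
if and only if its upward closure contains all elements of `S` above (the principal filter
of) `p`. -/
def topologyOfSet (S : Set (Order.PFilter P)) : GrothendieckTopology P where
  sieves p := {L | {x | Order.PFilter.principal p ≤ x} ∩ S ⊆ sieveTilde L}
  top_mem' p x hx := ⟨p, 𝟙 p, trivial, hx.1⟩
  pullback_stable' p q L f hL x hx := by
    have hq : q ∈ x := Order.PFilter.principal_le_iff.1 hx.1
    obtain ⟨r, g, hg, hr⟩ :=
      hL ⟨Order.PFilter.principal_le_iff.2 (Order.PFilter.mem_of_le (leOfHom f) hq), hx.2⟩
    obtain ⟨t, ht, htq, htr⟩ := x.directed q hq r (Order.PFilter.principal_le_iff.1 hr)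
    refine ⟨t, homOfLE htq, ?_, Order.PFilter.principal_le_iff.2 ht⟩
    have := L.downward_closed hg (homOfLE htr)
    rwa [Subsingleton.elim (homOfLE htr ≫ g) (homOfLE htq ≫ f)] at this
  transitive' p L hL R hR x hx := by
    obtain ⟨q, f, hf, hq⟩ := hL hx
    obtain ⟨r, g, hg, hr⟩ := hR hf ⟨hq, hx.2⟩
    exact ⟨r, g ≫ f, hg, hr⟩

end Filters

/-! Everything reduces to finiteness of compact opens. The sets `filterNhd p` form a basis of X, and
each is the least open neighbourhood of the principal filter of p, hence compact. X is always sober,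
so it is spectral iff P is the down-closure of a finite set and so is the set of common lower bounds
of any two elements (`spectralSpace_pFilter_iff`). In PSh(P) these conditions say that the terminal
object and the products of two representables are compact. Coherence forces this. Conversely,
representables are compact subterminal generators, and `IsCoherentGenerating` then makes the
coherent objects a generating class closed under finite limits (`isCoherentTopos_presheaf_iff`).

For sober S, conditions (b), (c), (d) each amount to compactness of the traces on S of compact
opens. For (b), soberness supplies the only part of spectrality that is not inherited. For (c),
covering sieves on p correspond to open covers of `filterNhd p ∩ S`. For (d), restriction to S takes
the sheaf represented by U to the one represented by U ∩ S, a represented sheaf is compact iff its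
open set is, and a left exact left adjoint preserves coherence once it does so on generators
(`IsCoherentGenerating.map_isCoherentObj`). Finally (a) and (b) are linked by the patch topology on
X being compact Hausdorff. -/

/-! ### Jointly epimorphic sieves and compact objects. -/

section JointlyEpi

variable {T : Type w} [Category.{v} T]

/-- A sieve is jointly epi if morphisms out of its codomain are determined by their composites with
the members of the sieve. -/
def CategoryTheory.Sieve.IsJointlyEpi {E : T} (S : Sieve E) : Prop :=
  ∀ ⦃Z : T⦄ (g h : E ⟶ Z), (∀ ⦃Y : T⦄ (f : Y ⟶ E), S f → f ≫ g = f ≫ h) → g = h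

lemma isJointlyEpi_ofArrows_iff {E : T} {ι : Type w'} (D : ι → T) (f : ∀ i, D i ⟶ E) :
    (Sieve.ofArrows D f).IsJointlyEpi ↔ IsEpimorphicFamily D f := by
  refine ⟨fun H Z g h e => H g h ?_, fun H Z g h e => H g h fun i => e _ (Sieve.ofArrows_mk D f i)⟩
  rintro Y k hk
  obtain ⟨i, a, rfl⟩ := (Sieve.mem_ofArrows_iff _ _ _).1 hk
  simp [e i]

namespace CategoryTheory.Sieve.IsJointlyEpi

lemma mono {E : T} {S R : Sieve E} (hS : S.IsJointlyEpi) (h : S ≤ R) : R.IsJointlyEpi :=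
  fun _ g k e => hS g k fun _ f hf => e f (h _ hf)

lemma top (E : T) : (⊤ : Sieve E).IsJointlyEpi := fun _ g h e => by
  simpa using e (𝟙 E) trivial

lemma trans {E : T} {S R : Sieve E} (hS : S.IsJointlyEpi)
    (h : ∀ ⦃Y⦄ (f : Y ⟶ E), S f → (R.pullback f).IsJointlyEpi) : R.IsJointlyEpi :=
  fun _ g k e => hS g k fun _ f hf => h f hf _ _ fun _ a ha => by
    simpa using e (a ≫ f) ha

end CategoryTheory.Sieve.IsJointlyEpi

variable (T) in
/-- Jointly epi sieves are stable under pullback. -/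
def StableJointlyEpi : Prop :=
  ∀ ⦃E E' : T⦄ (g : E' ⟶ E) (S : Sieve E), S.IsJointlyEpi → (S.pullback g).IsJointlyEpi

lemma StableJointlyEpi.inf (hT : StableJointlyEpi T) {E : T} {S R : Sieve E}
    (hS : S.IsJointlyEpi) (hR : R.IsJointlyEpi) : (S ⊓ R).IsJointlyEpi :=
  hS.trans fun _ f hf => (hT f R hR).mono fun _ a ha => ⟨S.downward_closed hf a, ha⟩

/-- The sieve of morphisms that factor through an object satisfying `G`. -/
def sieveThrough (G : ObjectProperty T) (E : T) : Sieve E where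
  arrows Y f := ∃ (A : T) (a : Y ⟶ A) (b : A ⟶ E), G A ∧ a ≫ b = f
  downward_closed := by
    rintro Y Z f ⟨A, a, b, hA, rfl⟩ g
    exact ⟨A, g ≫ a, b, hA, by simp⟩

lemma isJointlyEpi_sieveThrough {G : ObjectProperty T} (hG : G.IsSeparating) (E : T) :
    (sieveThrough G E).IsJointlyEpi :=
  fun _ g h e => hG g h fun A hA k => e k ⟨A, 𝟙 _, k, hA, by simp⟩

lemma StableJointlyEpi.of_isSeparating {G : ObjectProperty T} (hG : G.IsSeparating)
    (h : ∀ ⦃A E : T⦄ (_ : G A) (x : A ⟶ E) (S : Sieve E), S.IsJointlyEpi →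
      (S.pullback x).IsJointlyEpi) : StableJointlyEpi T := by
  intro E E' g S hS Z k l e
  refine hG k l fun A hA b => h hA (b ≫ g) S hS _ _ fun Y a ha => ?_
  simpa using e (a ≫ b) (by simpa using ha)

/-- With index types in `Type`, finite families can be combined by sums and products without
universe constraints. -/
lemma isCompactObj_iff {E : T} : IsCompactObj E ↔ ∀ S : Sieve E, S.IsJointlyEpi →
    ∃ (ι : Type) (_ : Finite ι) (D : ι → T) (f : ∀ i, D i ⟶ E), (∀ i, S (f i)) ∧
      (Sieve.ofArrows D f).IsJointlyEpi := by
  classical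
  constructor
  · intro h S hS
    obtain ⟨s, hs⟩ := h (ι := Σ Y : T, {f : Y ⟶ E // S f}) (fun i => i.1) (fun i => i.2.1)
      fun Z a b e => hS a b fun Y f hf => e ⟨Y, f, hf⟩
    refine ⟨Fin s.card, inferInstance, fun i => (s.equivFin.symm i).1.1,
      fun i => (s.equivFin.symm i).1.2.1, fun i => (s.equivFin.symm i).1.2.2, ?_⟩
    rw [isJointlyEpi_ofArrows_iff]
    intro Z a b e
    refine hs a b fun i => ?_
    have := e (s.equivFin i)
    dsimp only at this ⊢
    rwa [Equiv.symm_apply_apply] at this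
  · intro h ι D f hf
    obtain ⟨κ, _, D', f', h₁, h₂⟩ := h _ ((isJointlyEpi_ofArrows_iff D f).2 hf)
    have := Fintype.ofFinite κ
    choose j a e using fun k => (Sieve.mem_ofArrows_iff _ _ _).1 (h₁ k)
    refine ⟨Finset.univ.image j, fun Z g k hgk => ?_⟩
    refine (isJointlyEpi_ofArrows_iff _ _).1 h₂ g k fun i => ?_
    rw [e i, Category.assoc, Category.assoc]
    rw [hgk ⟨j i, by simp⟩]

lemma isCompactObj_of_cover (hT : StableJointlyEpi T) {E : T} {ι : Type} [Finite ι] (D : ι → T)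
    (f : ∀ i, D i ⟶ E) (hf : (Sieve.ofArrows D f).IsJointlyEpi) (hD : ∀ i, IsCompactObj (D i)) :
    IsCompactObj E := by
  rw [isCompactObj_iff]
  intro S hS
  choose κ _ D' f' h₁ h₂ using fun i => isCompactObj_iff.1 (hD i) _ (hT (f i) S hS)
  refine ⟨Σ i, κ i, inferInstance, fun k => D' k.1 k.2, fun k => f' k.1 k.2 ≫ f k.1,
    fun k => h₁ k.1 k.2, ?_⟩
  rw [isJointlyEpi_ofArrows_iff] at hf ⊢
  intro Z g h e
  refine hf g h fun i => (isJointlyEpi_ofArrows_iff _ _).1 (h₂ i) _ _ fun k => ?_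
  simpa using e ⟨i, k⟩

lemma IsCompactObj.of_iso {E E' : T} (hE : IsCompactObj E) (e : E ≅ E') : IsCompactObj E' := by
  intro ι D f hf
  obtain ⟨s, hs⟩ := hE D (fun i => f i ≫ e.inv) fun Z g h H =>
    (cancel_epi e.inv).1 (hf _ _ fun i => by simpa using H i)
  refine ⟨s, fun Z g h H => (cancel_epi e.hom).1 (hs _ _ fun i => ?_)⟩
  simpa using H i

lemma IsCompactObj.exists_cover {G : ObjectProperty T} (hG : G.IsSeparating)
    {E : T} (hE : IsCompactObj E) {S : Sieve E} (hS : S.IsJointlyEpi) :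
    ∃ (ι : Type) (_ : Finite ι) (D : ι → T) (f : ∀ i, D i ⟶ E), (∀ i, G (D i)) ∧
      (∀ i, S (f i)) ∧ (Sieve.ofArrows D f).IsJointlyEpi := by
  -- A finite epimorphic family in R factors through members of S with source in `G`, and these then
  -- form an epimorphic family themselves.
  let R : Sieve E :=
    { arrows := fun Y f => ∃ (A : T) (a : Y ⟶ A) (b : A ⟶ E), G A ∧ S b ∧ a ≫ b = f
      downward_closed := by
        rintro Y Z f ⟨A, a, b, hA, hb, rfl⟩ g
        exact ⟨A, g ≫ a, b, hA, hb, by simp⟩ }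
  have hR : R.IsJointlyEpi := hS.trans fun Y f hf =>
    (isJointlyEpi_sieveThrough hG Y).mono <| by
      rintro Z _ ⟨A, a, b, hA, rfl⟩
      exact ⟨A, a, b ≫ f, hA, S.downward_closed hf b, by simp⟩
  obtain ⟨ι, _, D, f, h₁, h₂⟩ := isCompactObj_iff.1 hE R hR
  choose A a b hA hb e using h₁
  refine ⟨ι, inferInstance, A, b, hA, hb, h₂.mono ?_⟩
  rintro Y _ hk
  obtain ⟨i, c, rfl⟩ := (Sieve.mem_ofArrows_iff _ _ _).1 hk
  rw [← e i, ← Category.assoc]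
  exact Sieve.downward_closed _ (Sieve.ofArrows_mk _ _ i) _

/-- The fibre products of the A i with the B k over E cover the pullback: the two covers, pulled
back along the projections, intersect in an epimorphic sieve whose arrows factor through such
products. -/
lemma isCompactObj_pullback_of_covers (hT : StableJointlyEpi T) [HasPullbacks T] {E₁ E₂ E : T}
    (f₁ : E₁ ⟶ E) (f₂ : E₂ ⟶ E) {ι κ : Type} [Finite ι] [Finite κ] {A : ι → T} {B : κ → T}
    (a : ∀ i, A i ⟶ E₁) (b : ∀ k, B k ⟶ E₂) (ha : (Sieve.ofArrows A a).IsJointlyEpi)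
    (hb : (Sieve.ofArrows B b).IsJointlyEpi)
    (h : ∀ i k, IsCompactObj (pullback (a i ≫ f₁) (b k ≫ f₂))) :
    IsCompactObj (pullback f₁ f₂) := by
  refine isCompactObj_of_cover hT (ι := ι × κ) (fun k => pullback (a k.1 ≫ f₁) (b k.2 ≫ f₂))
    (fun k => pullback.map _ _ _ _ (a k.1) (b k.2) (𝟙 _) (by simp) (by simp)) ?_ fun k => h _ _
  refine (hT.inf (hT (pullback.fst f₁ f₂) _ ha) (hT (pullback.snd f₁ f₂) _ hb)).mono ?_
  rintro Y g ⟨h₁, h₂⟩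
  obtain ⟨i, c, hc⟩ := (Sieve.mem_ofArrows_iff _ _ _).1 h₁
  obtain ⟨k, d, hd⟩ := (Sieve.mem_ofArrows_iff _ _ _).1 h₂
  have hcd : c ≫ a i ≫ f₁ = d ≫ b k ≫ f₂ := by
    rw [← Category.assoc, ← Category.assoc, ← hc, ← hd, Category.assoc, Category.assoc,
      pullback.condition]
  have key : g = pullback.lift c d hcd ≫ pullback.map (a i ≫ f₁) (b k ≫ f₂) f₁ f₂ (a i) (b k)
      (𝟙 _) (by simp) (by simp) := by
    refine pullback.hom_ext ?_ ?_
    · rw [Category.assoc, pullback.map, pullback.lift_fst, pullback.lift_fst_assoc, hc]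
    · rw [Category.assoc, pullback.map, pullback.lift_snd, pullback.lift_snd_assoc, hd]
  exact (Sieve.mem_ofArrows_iff _ _ _).2 ⟨(i, k), _, key⟩

lemma isCoherentObj_iff [HasPullbacks T] {E : T} : IsCoherentObj E ↔ IsCompactObj E ∧
    ∀ ⦃E₁ E₂ : T⦄ (f₁ : E₁ ⟶ E) (f₂ : E₂ ⟶ E), IsCompactObj E₁ → IsCompactObj E₂ →
      IsCompactObj (pullback f₁ f₂) :=
  ⟨fun h => ⟨h.1, fun _ _ _ _ => h.2 _ _ _ _ (.of_hasPullback _ _)⟩,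
    fun h => ⟨h.1, fun _ _ _ _ _ _ _ hp h₁ h₂ => (h.2 _ _ h₁ h₂).of_iso hp.isoPullback.symm⟩⟩

/-! ### Coherent objects in the presence of compact subterminal generators. -/

/-- An object with at most one morphism into it from any object. -/
def IsSubterminalObj (A : T) : Prop := ∀ ⦃Z : T⦄ (f g : Z ⟶ A), f = g

/-- An object property consisting of compact subterminal generators that makes the coherent objects
of the ambient category well behaved. -/
structure IsCoherentGenerating [HasFiniteLimits T] (G : ObjectProperty T) : Prop where
  stable : StableJointlyEpi T
  isSeparating : G.IsSeparating
  isCompactObj : ∀ ⦃A⦄, G A → IsCompactObj A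
  isSubterminalObj : ∀ ⦃A⦄, G A → IsSubterminalObj A
  isCompactObj_terminal : IsCompactObj (⊤_ T)
  isCompactObj_pullback : ∀ ⦃A B C : T⦄ (f : A ⟶ C) (g : B ⟶ C), G A → G B →
    IsSubterminalObj C → IsCompactObj (pullback f g)

namespace IsCoherentGenerating

variable [HasFiniteLimits T] {G : ObjectProperty T}

lemma isCoherentObj_of_isSubterminalObj (hG : IsCoherentGenerating G) {C : T}
    (hC : IsCompactObj C) (hC' : IsSubterminalObj C) : IsCoherentObj C := by
  refine isCoherentObj_iff.2 ⟨hC, fun E₁ E₂ f₁ f₂ h₁ h₂ => ?_⟩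
  obtain ⟨ι, _, A, a, hA, -, ha⟩ := h₁.exists_cover hG.isSeparating (.top E₁)
  obtain ⟨κ, _, B, b, hB, -, hb⟩ := h₂.exists_cover hG.isSeparating (.top E₂)
  exact isCompactObj_pullback_of_covers hG.stable f₁ f₂ a b ha hb fun i k =>
    hG.isCompactObj_pullback _ _ (hA i) (hB k) hC'

lemma isCoherentObj (hG : IsCoherentGenerating G) {A : T} (hA : G A) : IsCoherentObj A :=
  hG.isCoherentObj_of_isSubterminalObj (hG.isCompactObj hA) (hG.isSubterminalObj hA)

lemma isCoherentObj_terminal (hG : IsCoherentGenerating G) : IsCoherentObj (⊤_ T) :=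
  hG.isCoherentObj_of_isSubterminalObj hG.isCompactObj_terminal fun _ _ _ => Subsingleton.elim _ _

/-- Generators A and B over E may be chosen to factor through some D i and D j. Then A ×_E B is A
×_{D i} (D i ×_E D j) ×_{D j} B, and two pullbacks over coherent objects keep it compact. -/
lemma isCoherentObj_of_cover (hG : IsCoherentGenerating G) {E : T} {ι : Type}
    [Finite ι] (D : ι → T) (d : ∀ i, D i ⟶ E)
    (hd : (Sieve.ofArrows D d).IsJointlyEpi) (hD : ∀ i, IsCoherentObj (D i))
    (h : ∀ i j, IsCompactObj (pullback (d i) (d j))) : IsCoherentObj E := by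
  refine isCoherentObj_iff.2
    ⟨isCompactObj_of_cover hG.stable D d hd fun i => (hD i).1, fun E₁ E₂ f₁ f₂ h₁ h₂ => ?_⟩
  obtain ⟨κ₁, _, A, a, hA, ha', ha⟩ :=
    h₁.exists_cover hG.isSeparating (hG.stable f₁ _ hd)
  obtain ⟨κ₂, _, B, b, hB, hb', hb⟩ :=
    h₂.exists_cover hG.isSeparating (hG.stable f₂ _ hd)
  refine isCompactObj_pullback_of_covers hG.stable f₁ f₂ a b ha hb fun k l => ?_
  obtain ⟨i, s, hs⟩ := (Sieve.mem_ofArrows_iff _ _ _).1 (ha' k)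
  obtain ⟨j, t, ht⟩ := (Sieve.mem_ofArrows_iff _ _ _).1 (hb' l)
  have h₁ := (isCoherentObj_iff.1 (hD i)).2 s (pullback.fst (d i) (d j))
    (hG.isCompactObj (hA k)) (h i j)
  have h₂ := (isCoherentObj_iff.1 (hD j)).2
    (pullback.snd s (pullback.fst (d i) (d j)) ≫ pullback.snd (d i) (d j)) t h₁
    (hG.isCompactObj (hB l))
  have p₁ := (IsPullback.of_hasPullback s (pullback.fst (d i) (d j))).paste_vert
    (IsPullback.of_hasPullback (d i) (d j))
  have p₂ := (IsPullback.of_hasPullback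
    (pullback.snd s (pullback.fst (d i) (d j)) ≫ pullback.snd (d i) (d j)) t).flip.paste_vert
      p₁.flip
  exact h₂.of_iso (p₂.flip.isoPullback ≪≫ pullback.congrHom hs.symm ht.symm)

/-- Cover Q = A ×_C B by generators D i. As these are subterminal, D i ×_Q D j is the product of D i
×_A D j and D i ×_B D j over the terminal object. Coherence of A, B and the terminal object makes
this compact. -/
lemma isCoherentObj_pullback (hG : IsCoherentGenerating G) {A B C : T}
    (f : A ⟶ C) (g : B ⟶ C) (hA : IsCoherentObj A)
    (hB : IsCoherentObj B) (hC : IsCoherentObj C) : IsCoherentObj (pullback f g) := by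
  have hc := (isCoherentObj_iff.1 hC).2 f g hA.1 hB.1
  obtain ⟨ι, _, D, d, hD, -, hd⟩ := hc.exists_cover hG.isSeparating (.top _)
  refine hG.isCoherentObj_of_cover D d hd (fun i => hG.isCoherentObj (hD i)) fun i j => ?_
  have hsub {E : T} (x : D i ⟶ E) (y : D j ⟶ E) : IsSubterminalObj (pullback x y) :=
    fun _ _ _ => pullback.hom_ext (hG.isSubterminalObj (hD i) _ _)
      (hG.isSubterminalObj (hD j) _ _)
  let PA := pullback (d i ≫ pullback.fst f g) (d j ≫ pullback.fst f g)
  let PB := pullback (d i ≫ pullback.snd f g) (d j ≫ pullback.snd f g)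
  have hPA : IsCompactObj PA :=
    (isCoherentObj_iff.1 hA).2 _ _ (hG.isCompactObj (hD i)) (hG.isCompactObj (hD j))
  have hPB : IsCompactObj PB :=
    (isCoherentObj_iff.1 hB).2 _ _ (hG.isCompactObj (hD i)) (hG.isCompactObj (hD j))
  have hQ := (isCoherentObj_iff.1 hG.isCoherentObj_terminal).2 (terminal.from PA)
    (terminal.from PB) hPA hPB
  have hQ' : IsSubterminalObj (pullback (terminal.from PA) (terminal.from PB)) :=
    fun _ _ _ => pullback.hom_ext (hsub _ _ _ _) (hsub _ _ _ _)
  -- Both sides are subterminal, so morphisms in the two directions already form an isomorphism.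
  refine hQ.of_iso ⟨pullback.lift (pullback.fst _ _ ≫ pullback.fst _ _)
    (pullback.fst _ _ ≫ pullback.snd _ _) ?_, pullback.lift (pullback.lift (pullback.fst _ _)
      (pullback.snd _ _) ?_) (pullback.lift (pullback.fst _ _) (pullback.snd _ _) ?_) ?_,
    hQ' _ _, hsub _ _ _ _⟩
  · refine pullback.hom_ext ?_ ?_
    · simp only [Category.assoc]
      rw [pullback.condition]
    · have e₁ : (pullback.fst (terminal.from PA) (terminal.from PB) ≫ pullback.fst _ _) =
          pullback.snd (terminal.from PA) (terminal.from PB) ≫ pullback.fst _ _ :=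
        hG.isSubterminalObj (hD i) _ _
      have e₂ : (pullback.fst (terminal.from PA) (terminal.from PB) ≫ pullback.snd _ _) =
          pullback.snd (terminal.from PA) (terminal.from PB) ≫ pullback.snd _ _ :=
        hG.isSubterminalObj (hD j) _ _
      rw [e₁, e₂]
      simp only [Category.assoc]
      rw [pullback.condition]
  · rw [← Category.assoc, pullback.condition, Category.assoc]
  · rw [← Category.assoc, pullback.condition, Category.assoc]
  · exact Subsingleton.elim _ _

lemma isClosedUnderIsomorphisms_isCoherentObj :
    ObjectProperty.IsClosedUnderIsomorphisms (IsCoherentObj : ObjectProperty T) where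
  of_iso {A B} e h := isCoherentObj_iff.2 ⟨h.1.of_iso e, fun E₁ E₂ f₁ f₂ h₁ h₂ =>
    h.2 (pullback.fst f₁ f₂) (pullback.snd f₁ f₂) (f₁ ≫ e.inv) (f₂ ≫ e.inv)
      ((IsPullback.of_hasPullback f₁ f₂).of_iso (Iso.refl _) (Iso.refl _) (Iso.refl _) e.symm
        (by simp) (by simp) (by simp) (by simp)) h₁ h₂⟩

lemma isClosedUnderLimitsOfShape (hG : IsCoherentGenerating G) (J : Type)
    [SmallCategory J] [FinCategory J] :
    ObjectProperty.IsClosedUnderLimitsOfShape (IsCoherentObj : ObjectProperty T) J := by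
  have := isClosedUnderIsomorphisms_isCoherentObj (T := T)
  let K : ObjectProperty T := IsCoherentObj
  have : K.IsClosedUnderIsomorphisms := this
  have h₁ : K.IsClosedUnderLimitsOfShape (Discrete PEmpty.{1}) := .mk' <| by
    rintro _ ⟨F, hF⟩
    exact K.prop_of_iso (HasLimit.isoOfNatIso (Functor.uniqueFromEmpty F).symm)
      hG.isCoherentObj_terminal
  have h₂ : K.IsClosedUnderLimitsOfShape WalkingCospan := .mk' <| by
    rintro _ ⟨F, hF⟩
    exact K.prop_of_iso (HasLimit.isoOfNatIso (diagramIsoCospan F).symm)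
      (hG.isCoherentObj_pullback _ _ (hF _) (hF _) (hF _))
  have : HasTerminal K.FullSubcategory := inferInstance
  have : HasPullbacks K.FullSubcategory := inferInstance
  have := hasFiniteLimits_of_hasTerminal_and_pullbacks (C := K.FullSubcategory)
  have := preservesFiniteLimits_of_preservesTerminal_and_pullbacks K.ι
  exact K.isClosedUnderLimitsOfShape_of_preservesLimitsOfShape_ι J

lemma isSeparating_isCoherentObj (hG : IsCoherentGenerating G) :
    ObjectProperty.IsSeparating (IsCoherentObj : ObjectProperty T) := fun _ _ f g h =>
  hG.isSeparating f g fun A hA => h A (hG.isCoherentObj hA)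

end IsCoherentGenerating

section Functor

variable {T' : Type w'} [Category.{v'} T']

lemma CategoryTheory.Sieve.IsJointlyEpi.map_ofArrows (F : T ⥤ T') [F.IsLeftAdjoint] {E : T}
    {ι : Type*} {D : ι → T} {d : ∀ i, D i ⟶ E} (hd : (Sieve.ofArrows D d).IsJointlyEpi) :
    (Sieve.ofArrows (fun i => F.obj (D i)) (fun i => F.map (d i))).IsJointlyEpi := by
  rw [isJointlyEpi_ofArrows_iff] at hd ⊢
  intro Z g h e
  let adj := Adjunction.ofIsLeftAdjoint F
  refine (adj.homEquiv _ _).injective (hd _ _ fun i => ?_)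
  rw [← adj.homEquiv_naturality_left, ← adj.homEquiv_naturality_left, e i]

/-- A left exact left adjoint functor that sends the objects of `G` to coherent objects preserves
coherent objects. -/
lemma IsCoherentGenerating.map_isCoherentObj [HasFiniteLimits T] [HasFiniteLimits T']
    {G : ObjectProperty T} {G' : ObjectProperty T'} (hG : IsCoherentGenerating G)
    (hG' : IsCoherentGenerating G') (F : T ⥤ T') [F.IsLeftAdjoint] [PreservesFiniteLimits F]
    (hF : ∀ A, G A → IsCoherentObj (F.obj A)) {E : T} (hE : IsCoherentObj E) :
    IsCoherentObj (F.obj E) := by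
  -- Compact objects are finitely covered by generators, and left adjoints preserve epimorphic
  -- families.
  have hc {A : T} (hA : IsCompactObj A) : IsCompactObj (F.obj A) := by
    obtain ⟨ι, _, D, d, hD, -, hd⟩ := hA.exists_cover hG.isSeparating (.top _)
    exact isCompactObj_of_cover hG'.stable _ _ (hd.map_ofArrows F) fun i => (hF _ (hD i)).1
  obtain ⟨ι, _, D, d, hD, -, hd⟩ := hE.1.exists_cover hG.isSeparating (.top _)
  refine hG'.isCoherentObj_of_cover _ _ (hd.map_ofArrows F) (fun i => hF _ (hD i)) fun i j => ?_
  exact (hc ((isCoherentObj_iff.1 hE).2 (d i) (d j) (hG.isCompactObj (hD i))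
    (hG.isCompactObj (hD j)))).of_iso
      ((IsPullback.of_hasPullback (d i) (d j)).map F).isoPullback

end Functor

end JointlyEpi

/-! ### Coherent toposes: a criterion and two necessary conditions. -/

section CoherentTopos

variable {E : Type (u + 1)} [Category.{u} E] [HasFiniteLimits E]

lemma IsCoherentGenerating.isCoherentTopos {G : ObjectProperty E} (hG : IsCoherentGenerating G)
    (hE : IsGrothendieckTopos E) : IsCoherentTopos E :=
  ⟨hE, IsCoherentObj, fun _ h => h.1, hG.isSeparating_isCoherentObj,
    fun J _ _ => hG.isClosedUnderLimitsOfShape J⟩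

lemma IsCoherentTopos.isCompactObj_terminal (hE : IsCoherentTopos E) : IsCompactObj (⊤_ E) := by
  obtain ⟨-, K, hK, -, hlim⟩ := hE
  have := hlim (Discrete PEmpty)
  exact hK _ K.prop_terminal

/-- A and B need not lie in the generating class K, but they are finitely covered by objects of K,
whose products stay in K. -/
lemma IsCoherentTopos.isCompactObj_pullback (hE : IsCoherentTopos E) (hs : StableJointlyEpi E)
    {A B : E} (hA : IsCompactObj A) (hB : IsCompactObj B) :
    IsCompactObj (pullback (terminal.from A) (terminal.from B)) := by
  obtain ⟨-, K, hK, hsep, hlim⟩ := hE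
  have := hlim (Discrete PEmpty)
  have := hlim WalkingCospan
  obtain ⟨ι, _, D, d, hD, -, hd⟩ := hA.exists_cover hsep (.top _)
  obtain ⟨κ, _, D', d', hD', -, hd'⟩ := hB.exists_cover hsep (.top _)
  refine isCompactObj_pullback_of_covers hs _ _ d d' hd hd' fun i j => hK _ ?_
  refine K.prop_limit _ ?_
  rintro (_ | _ | _)
  exacts [K.prop_terminal, hD i, hD' j]

end CoherentTopos

/-! ### Compact and coherent sheaves on a space. -/

section SheavesOnSpace

open TopologicalSpace Opposite

variable {X : Type u} [TopologicalSpace X]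

instance Opens.subcanonical_grothendieckTopology :
    (Opens.grothendieckTopology X).Subcanonical :=
  .of_isSheaf_yoneda_obj _ fun W U S hS x _ => by
    have hUW : U ≤ W := fun p hp => by
      obtain ⟨V, f, hf, hV⟩ := hS p hp
      exact (leOfHom (x f hf)) hV
    exact ⟨homOfLE hUW, fun V _ _ => Subsingleton.elim (α := V ⟶ W) _ _,
      fun _ _ => Subsingleton.elim (α := U ⟶ W) _ _⟩

/-- The sheaf represented by an open set. -/
noncomputable abbrev opensSheaf (U : Opens X) : Sheaf (Opens.grothendieckTopology X) (Type u) :=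
  (Opens.grothendieckTopology X).yoneda.obj U

/-- The morphism of representable sheaves given by an inclusion of open sets. -/
noncomputable abbrev opensSheafMap {U V : Opens X} (h : U ≤ V) : opensSheaf U ⟶ opensSheaf V :=
  (Opens.grothendieckTopology X).yoneda.map (homOfLE h)

lemma isSubterminalObj_opensSheaf (U : Opens X) : IsSubterminalObj (opensSheaf U) := by
  intro Z f g
  ext V x
  exact Subsingleton.elim (α := unop V ⟶ U) _ _

lemma le_of_opensSheaf_hom {U V : Opens X} (f : opensSheaf U ⟶ opensSheaf V) : U ≤ V :=
  leOfHom ((Opens.grothendieckTopology X).yonedaFullyFaithful.preimage f)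

lemma hom_ext_of_locally {F : Sheaf (Opens.grothendieckTopology X) (Type u)} {U : Opens X}
    {a b : opensSheaf U ⟶ F}
    (h : ∀ p ∈ U, ∃ (V : Opens X) (hV : V ≤ U), p ∈ V ∧
      opensSheafMap hV ≫ a = opensSheafMap hV ≫ b) : a = b := by
  let J := Opens.grothendieckTopology X
  let S : Sieve U :=
    { arrows := fun V f => J.yoneda.map f ≫ a = J.yoneda.map f ≫ b
      downward_closed := fun {V W f} hf g => by simp [hf] }
  have hS : S ∈ J U := fun p hp => by
    obtain ⟨V, hV, hp, e⟩ := h p hp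
    exact ⟨V, homOfLE hV, e, hp⟩
  refine J.yonedaEquiv.injective
    (((isSheaf_iff_isSheaf_of_type _ _).1 F.property S hS).isSeparatedFor.ext fun V f hf => ?_)
  rw [J.yonedaEquiv_naturality, J.yonedaEquiv_naturality]
  exact congrArg _ hf

variable (X) in
/-- The sheaves represented by open sets. -/
def IsOpensSheaf : ObjectProperty (Sheaf (Opens.grothendieckTopology X) (Type u)) :=
  fun A => ∃ U : Opens X, A = opensSheaf U

lemma isSeparating_isOpensSheaf : (IsOpensSheaf X).IsSeparating := fun _ _ _ _ h =>
  (Opens.grothendieckTopology X).hom_ext_yoneda fun U p => h _ ⟨U, rfl⟩ p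

/-- The sections whose classifying morphism lies in S form a subpresheaf A of F. Every member of S
factors through the sheaf B of sections locally in A, so B → F is epi, hence locally surjective. -/
lemma CategoryTheory.Sieve.IsJointlyEpi.locally_mem
    {F : Sheaf (Opens.grothendieckTopology X) (Type u)} {S : Sieve F} (hS : S.IsJointlyEpi)
    {U : Opens X} (x : opensSheaf U ⟶ F) {p : X} (hp : p ∈ U) :
    ∃ (V : Opens X) (hV : V ≤ U), p ∈ V ∧ S (opensSheafMap hV ≫ x) := by
  let J := Opens.grothendieckTopology X
  let A : Subfunctor F.obj :=
    { obj := fun V => {s | S (J.yonedaEquiv.symm s)}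
      map := fun {V W} f s hs => by
        change S (J.yonedaEquiv.symm (F.obj.map f s))
        rw [J.yonedaEquiv_symm_map]
        exact S.downward_closed hs _ }
  let B : Sheaf J (Type u) := ⟨(A.sheafify J).toFunctor, by
    rw [isSheaf_iff_isSheaf_of_type]
    apply Subfunctor.sheafify_isSheaf
    rw [← isSheaf_iff_isSheaf_of_type]
    exact F.property⟩
  let i : B ⟶ F := ⟨(A.sheafify J).ι⟩
  have hi : Epi i := ⟨fun {Z} g h e => hS g h fun Y f hf => by
    refine J.hom_ext_yoneda fun W q => ?_
    have hs : J.yonedaEquiv (q ≫ f) ∈ A.obj (op W) := by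
      change S (J.yonedaEquiv.symm (J.yonedaEquiv (q ≫ f)))
      rw [Equiv.symm_apply_apply]
      exact S.downward_closed hf q
    let t : B.obj.obj (op W) := ⟨_, A.le_sheafify J _ hs⟩
    have ht : J.yonedaEquiv.symm t ≫ i = q ≫ f := by
      rw [J.yonedaEquiv_symm_naturality_right, Equiv.symm_apply_eq]
      rfl
    rw [← Category.assoc, ← Category.assoc, ← ht, Category.assoc, Category.assoc, e]⟩
  rw [← Sheaf.isLocallySurjective_iff_epi'] at hi
  obtain ⟨V, f, ⟨t, ht⟩, hpV⟩ := Presheaf.imageSieve_mem J i.hom (J.yonedaEquiv x) p hp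
  obtain ⟨W, g, hg, hpW⟩ := t.2 p hpV
  refine ⟨W, leOfHom (g ≫ f), hpW, ?_⟩
  change S (J.yonedaEquiv.symm (F.obj.map g.op t.1)) at hg
  replace ht : t.1 = F.obj.map f.op (J.yonedaEquiv x) := ht
  rw [ht, J.yonedaEquiv_naturality, J.yonedaEquiv_naturality, Equiv.symm_apply_apply,
    ← Category.assoc, ← Functor.map_comp] at hg
  exact hg

lemma stableJointlyEpi_sheaf :
    StableJointlyEpi (Sheaf (Opens.grothendieckTopology X) (Type u)) := by
  refine .of_isSeparating isSeparating_isOpensSheaf ?_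
  rintro _ E ⟨U, rfl⟩ x S hS Z g h e
  refine hom_ext_of_locally fun p hp => ?_
  obtain ⟨V, hV, hpV, hS'⟩ := hS.locally_mem x hp
  exact ⟨V, hV, hpV, e _ hS'⟩

lemma isJointlyEpi_opensSheaf {U : Opens X} {S : Sieve (opensSheaf U)}
    (h : ∀ p ∈ U, ∃ (V : Opens X) (hV : V ≤ U), p ∈ V ∧ S (opensSheafMap hV)) :
    S.IsJointlyEpi := fun _ _ _ e => hom_ext_of_locally fun p hp => by
  obtain ⟨V, hV, hpV, hS⟩ := h p hp
  exact ⟨V, hV, hpV, e _ hS⟩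

lemma isCompactObj_opensSheaf_iff {U : Opens X} :
    IsCompactObj (opensSheaf U) ↔ IsCompact (U : Set X) := by
  constructor
  · intro h
    refine isCompact_of_finite_subcover fun {ι} W hW hU => ?_
    -- The sieve generated by the open subsets of U that are small with respect to the cover W.
    let S : Sieve (opensSheaf U) :=
      { arrows := fun Y f => ∃ (V : Opens X) (hV : V ≤ U) (a : Y ⟶ opensSheaf V),
          (∃ i, (V : Set X) ⊆ W i) ∧ a ≫ opensSheafMap hV = f
        downward_closed := by
          rintro Y Z _ ⟨V, hV, a, hi, rfl⟩ g
          exact ⟨V, hV, g ≫ a, hi, by simp⟩ }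
    have hS : S.IsJointlyEpi := isJointlyEpi_opensSheaf fun p hp => by
      obtain ⟨i, hi⟩ := Set.mem_iUnion.1 (hU hp)
      exact ⟨U ⊓ ⟨W i, hW i⟩, inf_le_left, ⟨hp, hi⟩, _, inf_le_left, 𝟙 _,
        ⟨i, Set.inter_subset_right⟩, by simp⟩
    obtain ⟨κ, _, D, d, hd, hepi⟩ := isCompactObj_iff.1 h S hS
    choose V hV a hia e using hd
    choose i hi using hia
    have := Fintype.ofFinite κ
    classical
    refine ⟨Finset.univ.image i, fun p hp => ?_⟩
    obtain ⟨V', hV', hpV', h'⟩ := hepi.locally_mem (𝟙 _) hp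
    obtain ⟨k, b, -⟩ := (Sieve.mem_ofArrows_iff _ _ _).1 h'
    simp only [Finset.mem_image, Finset.mem_univ, true_and, Set.iUnion_exists,
      Set.iUnion_iUnion_eq', Set.mem_iUnion]
    exact ⟨k, hi k (le_of_opensSheaf_hom (b ≫ a k) hpV')⟩
  · intro hU
    refine isCompactObj_iff.2 fun S hS => ?_
    have key (p : U) : ∃ (V : Opens X) (hV : V ≤ U), p.1 ∈ V ∧ S (opensSheafMap hV) := by
      simpa using hS.locally_mem (𝟙 (opensSheaf U)) p.2
    choose V hV hpV hSV using key
    obtain ⟨t, ht⟩ := hU.elim_finite_subcover (fun p : U => (V p : Set X)) (fun p => (V p).2)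
      fun p hp => Set.mem_iUnion.2 ⟨⟨p, hp⟩, hpV _⟩
    refine ⟨Fin t.card, inferInstance, fun k => opensSheaf (V (t.equivFin.symm k).1),
      fun k => opensSheafMap (hV _), fun k => hSV (t.equivFin.symm k).1, ?_⟩
    refine isJointlyEpi_opensSheaf fun p hp => ?_
    obtain ⟨q, hq, hpq⟩ := Set.mem_iUnion₂.1 (ht hp)
    refine ⟨V q, hV q, hpq, (Sieve.mem_ofArrows_iff _ _ _).2
      ⟨t.equivFin ⟨q, hq⟩, opensSheafMap (by simp), ?_⟩⟩
    exact isSubterminalObj_opensSheaf _ _ _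

variable (X) in
/-- The sheaves represented by compact open sets. -/
def IsCompactOpensSheaf : ObjectProperty (Sheaf (Opens.grothendieckTopology X) (Type u)) :=
  fun A => ∃ U : Opens X, IsCompact (U : Set X) ∧ A = opensSheaf U

lemma isSeparating_isCompactOpensSheaf [PrespectralSpace X] :
    (IsCompactOpensSheaf X).IsSeparating := fun _ _ f g h => by
  refine isSeparating_isOpensSheaf f g ?_
  rintro _ ⟨U, rfl⟩ k
  refine hom_ext_of_locally fun p hp => ?_
  obtain ⟨V, ⟨hV, hVc⟩, hpV, hVU⟩ :=
    PrespectralSpace.isTopologicalBasis.mem_nhds_iff.1 (U.2.mem_nhds hp)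
  refine ⟨⟨V, hV⟩, hVU, hpV, ?_⟩
  simpa using h _ ⟨⟨V, hV⟩, hVc, rfl⟩ (opensSheafMap hVU ≫ k)

/-- Gives compactness of terminal objects and pullbacks without identifying them with represented
sheaves. -/
lemma isCompactObj_of_isJointlyEpi_hom {F : Sheaf (Opens.grothendieckTopology X) (Type u)}
    {U : Opens X} (hU : IsCompact (U : Set X)) (x : opensSheaf U ⟶ F)
    (h : ∀ (V : Opens X) (y : opensSheaf V ⟶ F), ∃ hV : V ≤ U, opensSheafMap hV ≫ x = y) :
    IsCompactObj F := by
  refine isCompactObj_of_cover stableJointlyEpi_sheaf (ι := Unit) (fun _ => opensSheaf U)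
    (fun _ => x) ?_ fun _ => isCompactObj_opensSheaf_iff.2 hU
  intro Z f g e
  refine isSeparating_isOpensSheaf f g ?_
  rintro _ ⟨V, rfl⟩ y
  obtain ⟨hV, rfl⟩ := h V y
  exact e _ ((Sieve.mem_ofArrows_iff _ _ _).2 ⟨(), _, rfl⟩)

lemma isCoherentGenerating_isCompactOpensSheaf [SpectralSpace X] :
    IsCoherentGenerating (IsCompactOpensSheaf X) where
  stable := stableJointlyEpi_sheaf
  isSeparating := isSeparating_isCompactOpensSheaf
  isCompactObj := by
    rintro _ ⟨U, hU, rfl⟩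
    exact isCompactObj_opensSheaf_iff.2 hU
  isSubterminalObj := by
    rintro _ ⟨U, hU, rfl⟩
    exact isSubterminalObj_opensSheaf U
  isCompactObj_terminal := isCompactObj_of_isJointlyEpi_hom (U := ⊤) isCompact_univ
    (terminal.from _) fun V y => ⟨le_top, Subsingleton.elim _ _⟩
  isCompactObj_pullback := by
    rintro _ _ C f g ⟨U, hU, rfl⟩ ⟨V, hV, rfl⟩ hC
    -- Over a subterminal object the fibre product of U and V is covered by U ∩ V, which is compact
    -- by quasi-separatedness.
    refine isCompactObj_of_isJointlyEpi_hom (U := U ⊓ V)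
      (QuasiSeparatedSpace.inter_isCompact _ _ U.2 hU V.2 hV)
      (pullback.lift (opensSheafMap inf_le_left) (opensSheafMap inf_le_right) (hC _ _))
      fun W y => ⟨le_inf (le_of_opensSheaf_hom (y ≫ pullback.fst _ _))
        (le_of_opensSheaf_hom (y ≫ pullback.snd _ _)), pullback.hom_ext
          (isSubterminalObj_opensSheaf _ _ _) (isSubterminalObj_opensSheaf _ _ _)⟩

end SheavesOnSpace

/-! ### Restriction of sheaves to a subspace. -/

section Subspace

open TopologicalSpace Opposite

variable {X : Type u} [TopologicalSpace X]

lemma isGrothendieckTopos_shTop : IsGrothendieckTopos (ShTop X) :=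
  ⟨Opens X, inferInstance, Opens.grothendieckTopology X, ⟨.refl⟩⟩

lemma isCoherentTopos_shTop [SpectralSpace X] : IsCoherentTopos (ShTop X) :=
  (isCoherentGenerating_isCompactOpensSheaf (X := X)).isCoherentTopos
    (isGrothendieckTopos_shTop (X := X))

/-- The preimage functor on open sets of an inducing map is locally full and cover dense, so that
pushforward of sheaves is fully faithful. -/
lemma GeomMorphism.isInclusion_ofTopCatHom {Y Z : TopCat.{u}} (f : Y ⟶ Z) (hf : IsInducing f) :
    (GeomMorphism.ofTopCatHom f).IsInclusion := by
  have h₁ : (Opens.map f).IsLocallyFull (Opens.grothendieckTopology Y) := ⟨fun {U V} g p hp =>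
    ⟨(Opens.map f).obj (U ⊓ V), homOfLE fun q hq => hq.1, ⟨U ⊓ V, homOfLE inf_le_left, 𝟙 _,
      ⟨homOfLE inf_le_right, Subsingleton.elim _ _⟩, Subsingleton.elim _ _⟩, hp, leOfHom g hp⟩⟩
  have h₂ : (Opens.map f).IsCoverDense (Opens.grothendieckTopology Y) := ⟨fun V p hp => by
    obtain ⟨U, hU, e⟩ := hf.isOpen_iff.1 V.2
    have hV : V = (Opens.map f).obj ⟨U, hU⟩ := Opens.ext e.symm
    exact ⟨V, 𝟙 V, ⟨⟨⟨U, hU⟩, eqToHom hV, eqToHom hV.symm, Subsingleton.elim _ _⟩⟩, hp⟩⟩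
  exact ⟨inferInstanceAs ((Opens.map f).sheafPushforwardContinuous (Type u)
      (Opens.grothendieckTopology Z) (Opens.grothendieckTopology Y)).Full,
    inferInstanceAs ((Opens.map f).sheafPushforwardContinuous (Type u)
      (Opens.grothendieckTopology Z) (Opens.grothendieckTopology Y)).Faithful⟩

/-- Restriction of sheaves to a subspace, as a functor between categories of sheaves on sites. -/
noncomputable abbrev restrictSheaf (S : Set X) :
    Sheaf (Opens.grothendieckTopology X) (Type u) ⥤
      Sheaf (Opens.grothendieckTopology S) (Type u) :=
  (GeomMorphism.ofSubspace S).inverse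

/-- The trace of an open set on a subspace. -/
abbrev opensTrace (S : Set X) (U : Opens X) : Opens S :=
  ⟨Subtype.val ⁻¹' (U : Set X), U.2.preimage continuous_subtype_val⟩

/-- By adjunction and Yoneda, both objects corepresent the functor of sections over U ∩ S. -/
lemma nonempty_restrictSheaf_opensSheaf_iso (S : Set X) (U : Opens X) :
    Nonempty ((restrictSheaf S).obj (opensSheaf U) ≅ opensSheaf (opensTrace S U)) := by
  let J := Opens.grothendieckTopology X
  let K := Opens.grothendieckTopology S
  let D : Sheaf K (Type u) ⥤ Sheaf J (Type u) := (GeomMorphism.ofSubspace S).direct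
  let adj : restrictSheaf S ⊣ D := (GeomMorphism.ofSubspace S).adj
  let H : Sheaf K (Type u) ⥤ Type u := sheafToPresheaf _ _ ⋙
    (evaluation _ _).obj (op (opensTrace S U))
  let c₁ : H.CorepresentableBy ((restrictSheaf S).obj (opensSheaf U)) :=
    { homEquiv := fun {F} => (adj.homEquiv _ F).trans (J.yonedaEquiv (F := D.obj F))
      homEquiv_comp := fun {F G} g f => by
        change J.yonedaEquiv (F := D.obj G) (adj.homEquiv _ _ (f ≫ g)) = _
        rw [adj.homEquiv_naturality_right]
        rfl }
  let c₂ : H.CorepresentableBy (opensSheaf (opensTrace S U)) :=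
    { homEquiv := fun {F} => K.yonedaEquiv (F := F)
      homEquiv_comp := fun {F G} g f => rfl }
  exact ⟨c₁.uniqueUpToIso c₂⟩

lemma isCoherentObj_opensSheaf [SpectralSpace X] {U : Opens X} (hU : IsCompact (U : Set X)) :
    IsCoherentObj (opensSheaf U) :=
  (isCoherentGenerating_isCompactOpensSheaf (X := X)).isCoherentObj ⟨U, hU, rfl⟩

lemma isCompact_trace_of_isCoherentSubtopos [SpectralSpace X] {S : Set X}
    (h : (GeomMorphism.ofSubspace S).IsCoherentSubtopos) {U : Opens X}
    (hU : IsCompact (U : Set X)) : IsCompact (Subtype.val ⁻¹' (U : Set X) : Set S) := by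
  obtain ⟨e⟩ := nonempty_restrictSheaf_opensSheaf_iso S U
  have h₁ : IsCoherentObj ((restrictSheaf S).obj (opensSheaf U)) :=
    h.2.map_coherent _ (isCoherentObj_opensSheaf hU)
  exact isCompactObj_opensSheaf_iff.1 (h₁.1.of_iso e)

lemma isCoherentSubtopos_of_isSpectralSubobject [SpectralSpace X] {S : Set X}
    (h : IsSpectralSubobject S) : (GeomMorphism.ofSubspace S).IsCoherentSubtopos := by
  have := h.1
  refine ⟨GeomMorphism.isInclusion_ofTopCatHom _ .subtypeVal, isCoherentTopos_shTop,
    isCoherentTopos_shTop,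
    fun A hA => ?_⟩
  have : (restrictSheaf S).IsLeftAdjoint := (GeomMorphism.ofSubspace S).adj.isLeftAdjoint
  have : PreservesFiniteLimits (restrictSheaf S) :=
    (GeomMorphism.ofSubspace S).preservesFiniteLimits
  refine isCoherentGenerating_isCompactOpensSheaf.map_isCoherentObj
    isCoherentGenerating_isCompactOpensSheaf (restrictSheaf S) ?_ hA
  rintro _ ⟨U, hU, rfl⟩
  obtain ⟨e⟩ := nonempty_restrictSheaf_opensSheaf_iso S U
  have := IsCoherentGenerating.isClosedUnderIsomorphisms_isCoherentObj
    (T := Sheaf (Opens.grothendieckTopology S) (Type u))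
  exact ObjectProperty.prop_of_iso _ e.symm (isCoherentObj_opensSheaf
    (h.2.isCompact_preimage_of_isOpen U.2 hU))

end Subspace

/-! ### Presheaves on a poset. -/

section Presheaf

open Opposite

/-- The presheaf analogue of `locally_mem`: epimorphisms are surjective at each object, so no
localization is needed. -/
lemma CategoryTheory.Sieve.IsJointlyEpi.mem_of_yoneda {C : Type u} [SmallCategory C]
    {F : Cᵒᵖ ⥤ Type u} {S : Sieve F} (hS : S.IsJointlyEpi) {c : C} (x : yoneda.obj c ⟶ F) :
    S x := by
  let A : Subfunctor F :=
    { obj := fun V => {s | S (yonedaEquiv.symm s)}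
      map := fun {V W} f s hs => by
        change S (yonedaEquiv.symm (F.map f s))
        rw [yonedaEquiv_symm_map]
        exact S.downward_closed hs _ }
  have hi : Epi A.ι := ⟨fun {Z} g h e => hS g h fun Y f hf => by
    refine hom_ext_yoneda fun W q => ?_
    have hs : yonedaEquiv (q ≫ f) ∈ A.obj (op W) := by
      change S (yonedaEquiv.symm (yonedaEquiv (q ≫ f)))
      rw [Equiv.symm_apply_apply]
      exact S.downward_closed hf q
    let t : A.toFunctor.obj (op W) := ⟨_, hs⟩
    have ht : yonedaEquiv.symm t ≫ A.ι = q ≫ f := by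
      rw [yonedaEquiv_symm_naturality_right, Equiv.symm_apply_eq]
      rfl
    rw [← Category.assoc, ← Category.assoc, ← ht, Category.assoc, Category.assoc, e]⟩
  rw [NatTrans.epi_iff_epi_app] at hi
  obtain ⟨t, ht⟩ := (epi_iff_surjective _).1 (hi (op c)) (yonedaEquiv x)
  have := t.2
  change S (yonedaEquiv.symm t.1) at this
  have e : t.1 = yonedaEquiv x := ht
  rwa [e, Equiv.symm_apply_apply] at this

/-- The representable presheaves. -/
def IsYonedaObj (C : Type u) [SmallCategory C] : ObjectProperty (Cᵒᵖ ⥤ Type u) :=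
  fun A => ∃ c : C, A = yoneda.obj c

variable {C : Type u} [SmallCategory C]

lemma isSeparating_isYonedaObj : (IsYonedaObj C).IsSeparating := fun _ _ _ _ h =>
  hom_ext_yoneda fun U p => h _ ⟨U, rfl⟩ p

lemma stableJointlyEpi_presheaf : StableJointlyEpi (Cᵒᵖ ⥤ Type u) := by
  refine .of_isSeparating isSeparating_isYonedaObj ?_
  rintro _ E ⟨c, rfl⟩ x S hS Z g h e
  simpa using e (𝟙 _) (by simpa using hS.mem_of_yoneda x)

lemma isCompactObj_yoneda (c : C) : IsCompactObj (yoneda.obj c) :=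
  isCompactObj_iff.2 fun S hS => ⟨Unit, inferInstance, fun _ => yoneda.obj c, fun _ => 𝟙 _,
    fun _ => hS.mem_of_yoneda _, fun Z g h e => by
      simpa using e (𝟙 _) (Sieve.ofArrows_mk _ (fun _ : Unit => 𝟙 (yoneda.obj c)) ())⟩

variable {P : Type u} [PartialOrder P]

lemma isSubterminalObj_yoneda (p : P) : IsSubterminalObj (yoneda.obj p) := by
  intro Z f g
  ext V x
  exact Subsingleton.elim (α := unop V ⟶ p) _ _

/-- A subterminal presheaf amounts to a down-closed subset of P, and compactness to its being
finitely generated. -/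
lemma isCompactObj_iff_exists_finset {A : Pᵒᵖ ⥤ Type u} (hA : IsSubterminalObj A) :
    IsCompactObj A ↔ ∃ t : Finset P, (∀ r ∈ t, Nonempty (yoneda.obj r ⟶ A)) ∧
      ∀ s, Nonempty (yoneda.obj s ⟶ A) → ∃ r ∈ t, s ≤ r := by
  classical
  constructor
  · intro h
    obtain ⟨ι, _, D, d, hD, -, hd⟩ := h.exists_cover isSeparating_isYonedaObj (.top _)
    choose r hr using hD
    have := Fintype.ofFinite ι
    refine ⟨Finset.univ.image r, ?_, ?_⟩
    · simp only [Finset.mem_image, Finset.mem_univ, true_and, forall_exists_index,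
        forall_apply_eq_imp_iff]
      exact fun i => ⟨eqToHom (hr i).symm ≫ d i⟩
    · rintro s ⟨x⟩
      obtain ⟨i, b, -⟩ := (Sieve.mem_ofArrows_iff _ _ _).1 (hd.mem_of_yoneda x)
      exact ⟨r i, by simp, leOfHom (Yoneda.fullyFaithful.preimage (b ≫ eqToHom (hr i)))⟩
  · rintro ⟨t, h₁, h₂⟩
    refine isCompactObj_of_cover stableJointlyEpi_presheaf (ι := Fin t.card)
      (fun i => yoneda.obj (t.equivFin.symm i).1)
      (fun i => (h₁ _ (t.equivFin.symm i).2).some) ?_ fun _ => isCompactObj_yoneda _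
    intro Z g h e
    refine hom_ext_yoneda fun s x => ?_
    obtain ⟨r, hr, hsr⟩ := h₂ s ⟨x⟩
    refine e _ ((Sieve.mem_ofArrows_iff _ _ _).2
      ⟨t.equivFin ⟨r, hr⟩, yoneda.map (homOfLE (by simpa using hsr)), hA _ _⟩)

lemma nonempty_yoneda_hom_pullback_iff {p q s : P} {A : Pᵒᵖ ⥤ Type u} (hA : IsSubterminalObj A)
    (f : yoneda.obj p ⟶ A) (g : yoneda.obj q ⟶ A) :
    Nonempty (yoneda.obj s ⟶ pullback f g) ↔ s ≤ p ∧ s ≤ q := by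
  constructor
  · rintro ⟨x⟩
    exact ⟨leOfHom (Yoneda.fullyFaithful.preimage (x ≫ pullback.fst f g)),
      leOfHom (Yoneda.fullyFaithful.preimage (x ≫ pullback.snd f g))⟩
  · rintro ⟨h₁, h₂⟩
    exact ⟨pullback.lift (yoneda.map (homOfLE h₁)) (yoneda.map (homOfLE h₂)) (hA _ _)⟩

lemma isCompactObj_pullback_yoneda_iff {p q : P} {A : Pᵒᵖ ⥤ Type u} (hA : IsSubterminalObj A)
    (f : yoneda.obj p ⟶ A) (g : yoneda.obj q ⟶ A) :
    IsCompactObj (pullback f g) ↔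
      ∃ t : Finset P, (∀ r ∈ t, r ≤ p ∧ r ≤ q) ∧ ∀ s, s ≤ p → s ≤ q → ∃ r ∈ t, s ≤ r := by
  rw [isCompactObj_iff_exists_finset fun _ _ _ => pullback.hom_ext
    (isSubterminalObj_yoneda _ _ _) (isSubterminalObj_yoneda _ _ _)]
  simp only [nonempty_yoneda_hom_pullback_iff hA, and_imp]

lemma isCompactObj_terminal_presheaf_iff :
    IsCompactObj (⊤_ (Pᵒᵖ ⥤ Type u)) ↔ ∃ t : Finset P, ∀ s, ∃ r ∈ t, s ≤ r := by
  rw [isCompactObj_iff_exists_finset fun _ _ _ => Subsingleton.elim _ _]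
  have (s : P) : Nonempty (yoneda.obj s ⟶ ⊤_ (Pᵒᵖ ⥤ Type u)) := ⟨terminal.from _⟩
  simp [this]

lemma isGrothendieckTopos_presheaf : IsGrothendieckTopos (Cᵒᵖ ⥤ Type u) :=
  ⟨C, inferInstance, ⊥, ⟨(sheafBotEquivalence _).symm⟩⟩

lemma isCoherentTopos_presheaf_iff : IsCoherentTopos (Pᵒᵖ ⥤ Type u) ↔
    (∃ t : Finset P, ∀ s, ∃ r ∈ t, s ≤ r) ∧
    ∀ p q : P, ∃ t : Finset P, (∀ r ∈ t, r ≤ p ∧ r ≤ q) ∧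
      ∀ s, s ≤ p → s ≤ q → ∃ r ∈ t, s ≤ r := by
  constructor
  · intro h
    exact ⟨isCompactObj_terminal_presheaf_iff.1 h.isCompactObj_terminal, fun p q =>
      (isCompactObj_pullback_yoneda_iff (fun _ _ _ => Subsingleton.elim _ _) _ _).1
        (h.isCompactObj_pullback stableJointlyEpi_presheaf (isCompactObj_yoneda p)
          (isCompactObj_yoneda q))⟩
  · rintro ⟨h₁, h₂⟩
    refine IsCoherentGenerating.isCoherentTopos (G := IsYonedaObj P)
      ⟨stableJointlyEpi_presheaf, isSeparating_isYonedaObj, ?_, ?_,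
        isCompactObj_terminal_presheaf_iff.2 h₁, ?_⟩ isGrothendieckTopos_presheaf
    · rintro _ ⟨p, rfl⟩
      exact isCompactObj_yoneda p
    · rintro _ ⟨p, rfl⟩
      exact isSubterminalObj_yoneda p
    · rintro _ _ A f g ⟨p, rfl⟩ ⟨q, rfl⟩ hA
      exact (isCompactObj_pullback_yoneda_iff hA f g).2 (h₂ p q)

end Presheaf

/-! ### Patches and spectral subobjects of a spectral space. -/

section Patch

open TopologicalSpace

variable {X : Type u} [TopologicalSpace X]

/-- Compact traces of compact opens form a basis of S closed under intersection, and S is itself the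
trace of X. -/
lemma isSpectralSubobject_iff [SpectralSpace X] {S : Set X} (hS : IsSoberSubspace S) :
    IsSpectralSubobject S ↔ ∀ U : Set X, IsOpen U → IsCompact U →
      IsCompact (Subtype.val ⁻¹' U : Set S) := by
  refine ⟨fun h U hU hUc => h.2.isCompact_preimage_of_isOpen hU hUc, fun h => ?_⟩
  have hmap : IsSpectralMap (Subtype.val : S → X) := ⟨continuous_subtype_val, h⟩
  have := hS.1
  have := hS.2
  have : PrespectralSpace S := .of_isInducing _ .subtypeVal hmap
  have : CompactSpace S := ⟨by simpa using h Set.univ isOpen_univ isCompact_univ⟩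
  have : QuasiSeparatedSpace S := by
    have hb : IsTopologicalBasis (Set.range fun U : {U : Set X // IsOpen U ∧ IsCompact U} =>
        (Subtype.val ⁻¹' U.1 : Set S)) := by
      convert! (PrespectralSpace.isTopologicalBasis (X := X)).isInducing
        (IsInducing.subtypeVal : IsInducing (Subtype.val : S → X))
      ext V
      simp [and_assoc]
    refine .of_isTopologicalBasis hb fun U V => ?_
    rw [← Set.preimage_inter]
    exact h _ (U.2.1.inter V.2.1) (U.2.2.inter_of_isOpen V.2.2 U.2.1 V.2.1)
  exact ⟨{}, hmap⟩

/-- A compact open containing just one of two points is clopen in the constructible topology. -/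
lemma t2Space_withConstructibleTopology [T0Space X] [PrespectralSpace X] :
    T2Space (WithConstructibleTopology X) := by
  have key (x y : X) (U : Set X) (hU : IsOpen U) (hx : x ∈ U) (hy : y ∉ U) :
      ∃ V : Set X, IsOpen[constructibleTopology X] V ∧ IsOpen[constructibleTopology X] Vᶜ ∧
        x ∈ V ∧ y ∉ V := by
    obtain ⟨V, ⟨hV, hVc⟩, hxV, hVU⟩ :=
      PrespectralSpace.isTopologicalBasis.mem_nhds_iff.1 (hU.mem_nhds hx)
    exact ⟨V, hVc.isOpen_constructibleTopology_of_isOpen hV,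
      IsCompact.isOpen_constructibleTopology_of_isClosed (by simpa using hVc) hV.isClosed_compl,
      hxV, fun h => hy (hVU h)⟩
  refine ⟨fun x y hxy => ?_⟩
  obtain ⟨U, hU, h⟩ := exists_isOpen_xor_mem
    (show x.ofTopology ≠ y.ofTopology from fun h => hxy (by cases x; cases y; exact congrArg _ h))
  have hpre (V : Set X) (hV : IsOpen[constructibleTopology X] V) :
      IsOpen {z : WithConstructibleTopology X | z.ofTopology ∈ V} :=
    WithConstructibleTopology.isOpen_iff.2 hV
  obtain ⟨hx, hy⟩ | ⟨hy, hx⟩ := h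
  · obtain ⟨V, h₁, h₂, hxV, hyV⟩ := key _ _ U hU hx hy
    exact ⟨_, _, hpre V h₁, hpre _ h₂, hxV, hyV,
      Set.disjoint_left.2 fun _ ha hb => hb ha⟩
  · obtain ⟨V, h₁, h₂, hyV, hxV⟩ := key _ _ U hU hy hx
    exact ⟨_, _, hpre _ h₂, hpre V h₁, hxV, hyV, Set.disjoint_left.2 fun _ ha hb => ha hb⟩

lemma constructibleTopology_le [PrespectralSpace X] :
    constructibleTopology X ≤ ‹TopologicalSpace X› := by
  intro U hU
  rw [PrespectralSpace.isTopologicalBasis.open_eq_sUnion' hU]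
  refine @isOpen_sUnion _ (constructibleTopology X) _ ?_
  rintro V ⟨⟨hV, hVc⟩, -⟩
  exact hVc.isOpen_constructibleTopology_of_isOpen hV

/-- U ∩ S is closed in the compact constructible topology, hence compact there and in the coarser
original topology. -/
lemma IsPatch.isCompact_preimage [SpectralSpace X] {S : Set X} (hS : IsPatch S) {U : Set X}
    (hU : IsOpen U) (hUc : IsCompact U) : IsCompact (Subtype.val ⁻¹' U : Set S) := by
  have hcl : IsClosed[constructibleTopology X] U :=
    (@isOpen_compl_iff _ _ (constructibleTopology X)).1
      (IsCompact.isOpen_constructibleTopology_of_isClosed (by simpa using hUc) hU.isClosed_compl)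
  have h₁ : IsClosed ({z : WithConstructibleTopology X | z.ofTopology ∈ U} ∩
      {z | z.ofTopology ∈ S}) :=
    .inter (WithConstructibleTopology.isClosed_iff.2 hcl)
      (WithConstructibleTopology.isClosed_iff.2 hS)
  have hcont : Continuous (fun z : WithConstructibleTopology X => z.ofTopology) :=
    continuous_def.2 fun V hV => WithConstructibleTopology.isOpen_iff.2
      (constructibleTopology_le V hV)
  rw [Subtype.isCompact_iff]
  convert h₁.isCompact.image hcont
  ext x
  constructor
  · rintro ⟨y, hy, rfl⟩
    exact ⟨.toTopology _ y.1, ⟨hy, y.2⟩, rfl⟩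
  · rintro ⟨⟨y⟩, hy, rfl⟩
    exact ⟨⟨y, hy.2⟩, hy.1, rfl⟩

/-- A spectral inclusion is continuous for the constructible topologies, so S is the image of a
compact space in a Hausdorff one. -/
lemma IsSpectralSubobject.isPatch [SpectralSpace X] {S : Set X} (hS : IsSpectralSubobject S) :
    IsPatch S := by
  have := hS.1
  have := t2Space_withConstructibleTopology (X := X)
  let g : WithConstructibleTopology S → WithConstructibleTopology X :=
    fun z => .toTopology _ z.ofTopology.1
  have hg : Continuous g := by
    have : @Continuous S X (constructibleTopology S) (constructibleTopology X) Subtype.val := by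
      refine continuous_generateFrom_iff.2 ?_
      rintro V (⟨hV, hVc⟩ | ⟨hV, hVc⟩)
      · exact (hS.2.isCompact_preimage_of_isOpen hV hVc).isOpen_constructibleTopology_of_isOpen
          (hV.preimage continuous_subtype_val)
      · exact (hS.2.isCompact_preimage_of_isOpen hV.isOpen_compl
          hVc).isOpen_constructibleTopology_of_isClosed (hV.preimage continuous_subtype_val)
    refine continuous_def.2 fun V hV => WithConstructibleTopology.isOpen_iff.2 ?_
    exact @Continuous.isOpen_preimage _ _ (_) (_) _ this _
      (WithConstructibleTopology.isOpen_iff.1 hV)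
  have hc := (isCompact_range hg).isClosed
  rw [WithConstructibleTopology.isClosed_iff] at hc
  have e : WithTopology.toTopology (constructibleTopology X) ⁻¹' Set.range g = S := by
    ext x
    constructor
    · rintro ⟨y, hy⟩
      cases hy
      exact y.ofTopology.2
    · intro hx
      exact ⟨.toTopology _ ⟨x, hx⟩, rfl⟩
  rwa [e] at hc

end Patch

/-! ### The Scott topology on filters. -/

section FilterSpace

open TopologicalSpace Order

variable {P : Type u} [PartialOrder P]

instance Order.PFilter.isScott : IsScott (PFilter P) Set.univ := ⟨rfl⟩

/-- The union of a directed set of filters. -/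
def Order.PFilter.directedUnion (d : Set (PFilter P)) (hd : d.Nonempty)
    (hd' : DirectedOn (· ≤ ·) d) : PFilter P :=
  IsPFilter.toPFilter (F := {p | ∃ x ∈ d, p ∈ x}) <| .of_def
    (by
      obtain ⟨x, hx⟩ := hd
      obtain ⟨p, hp⟩ := x.nonempty
      exact ⟨p, x, hx, hp⟩)
    (by
      rintro p ⟨x, hx, hp⟩ q ⟨y, hy, hq⟩
      obtain ⟨z, hz, hxz, hyz⟩ := hd' x hx y hy
      obtain ⟨r, hr, hrp, hrq⟩ := z.directed p (hxz hp) q (hyz hq)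
      exact ⟨r, ⟨z, hz, hr⟩, hrp, hrq⟩)
    (by
      rintro p q hpq ⟨x, hx, hp⟩
      exact ⟨x, hx, PFilter.mem_of_le hpq hp⟩)

/-- The filters that contain `p`. -/
def filterNhd (p : P) : Set (PFilter P) := {x | p ∈ x}

lemma mem_filterNhd {p : P} {x : PFilter P} : x ∈ filterNhd p ↔ p ∈ x := Iff.rfl

lemma isOpen_filterNhd (p : P) : IsOpen (filterNhd p) := by
  rw [IsScott.isOpen_iff_isUpperSet_and_dirSupInaccOn (D := Set.univ)]
  refine ⟨fun x y hxy hx => hxy hx, fun d _ hd hd' a ha hp => ?_⟩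
  -- The union is an upper bound of d, so the supremum a lies below it.
  obtain ⟨x, hx, hpx⟩ : p ∈ PFilter.directedUnion d hd hd' :=
    ha.2 (show PFilter.directedUnion d hd hd' ∈ upperBounds d from
      fun x hx q hq => ⟨x, hx, hq⟩) hp
  exact ⟨x, hx, hpx⟩

/-- A filter is the directed supremum of the principal filters of its elements, and Scott opens are
inaccessible by such suprema. -/
lemma exists_mem_principal_mem {U : Set (PFilter P)} (hU : IsOpen U) {x : PFilter P}
    (hx : x ∈ U) : ∃ p ∈ x, PFilter.principal p ∈ U := by
  rw [IsScott.isOpen_iff_isUpperSet_and_dirSupInaccOn (D := Set.univ)] at hU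
  have hlub : IsLUB (PFilter.principal '' (x : Set P)) x := by
    refine ⟨?_, fun y hy p hp => ?_⟩
    · rintro _ ⟨p, hp, rfl⟩
      exact PFilter.principal_le_iff.2 hp
    · exact PFilter.principal_le_iff.1 (hy ⟨p, hp, rfl⟩)
  obtain ⟨_, ⟨p, hp, rfl⟩, hpU⟩ := hU.2 (Set.mem_univ _) (x.nonempty.image _) (by
    rintro _ ⟨p, hp, rfl⟩ _ ⟨q, hq, rfl⟩
    obtain ⟨r, hr, hrp, hrq⟩ := x.directed p hp q hq
    exact ⟨_, ⟨r, hr, rfl⟩, PFilter.antitone_principal hrp, PFilter.antitone_principal hrq⟩)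
    hlub hx
  exact ⟨p, hp, hpU⟩

lemma filterNhd_subset_iff {U : Set (PFilter P)} (hU : IsOpen U) {p : P} :
    filterNhd p ⊆ U ↔ PFilter.principal p ∈ U :=
  ⟨fun h => h (le_refl p), fun h _ hx =>
    IsScott.isUpperSet_of_isOpen (D := Set.univ) hU (PFilter.principal_le_iff.2 hx) h⟩

lemma isTopologicalBasis_filterNhd : IsTopologicalBasis (Set.range (filterNhd (P := P))) := by
  refine isTopologicalBasis_of_isOpen_of_nhds ?_ fun x U hx hU => ?_
  · rintro _ ⟨p, rfl⟩
    exact isOpen_filterNhd p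
  · obtain ⟨p, hp, hpU⟩ := exists_mem_principal_mem hU hx
    exact ⟨_, ⟨p, rfl⟩, hp, (filterNhd_subset_iff hU).2 hpU⟩

lemma isCompact_filterNhd (p : P) : IsCompact (filterNhd p) := by
  refine isCompact_of_finite_subcover fun {ι} U hU hpU => ?_
  obtain ⟨i, hi⟩ := Set.mem_iUnion.1 (hpU (show PFilter.principal p ∈ filterNhd p from le_refl p))
  exact ⟨{i}, by simpa using (filterNhd_subset_iff (hU i)).2 hi⟩

lemma isCompact_iff_exists_finset {U : Set (PFilter P)} (hU : IsOpen U) :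
    IsCompact U ↔ ∃ t : Finset P, U = ⋃ r ∈ t, filterNhd r := by
  have := isCompact_open_iff_eq_finite_iUnion_of_isTopologicalBasis _
    isTopologicalBasis_filterNhd isCompact_filterNhd U
  simp only [hU, and_true] at this
  rw [this]
  constructor
  · rintro ⟨s, hs, h⟩
    exact ⟨hs.toFinset, by simpa using h⟩
  · rintro ⟨t, h⟩
    exact ⟨t, t.finite_toSet, by simpa using h⟩

instance Order.PFilter.prespectralSpace : PrespectralSpace (PFilter P) :=
  .of_isTopologicalBasis isTopologicalBasis_filterNhd (by
    rintro _ ⟨p, rfl⟩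
    exact isCompact_filterNhd p)

instance Order.PFilter.t0Space : T0Space (PFilter P) :=
  ⟨fun x y h => by
    ext p
    exact h.mem_open_iff (isOpen_filterNhd p)⟩

instance Order.PFilter.quasiSober : QuasiSober (PFilter P) := by
  refine ⟨fun {Z} hZ hZc => ?_⟩
  -- The generic point: irreducibility of Z makes this set down-directed.
  let x : PFilter P := IsPFilter.toPFilter (F := {p | (Z ∩ filterNhd p).Nonempty}) <| .of_def
    (by
      obtain ⟨z, hz⟩ := hZ.1
      obtain ⟨p, hp⟩ := z.nonempty
      exact ⟨p, z, hz, hp⟩)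
    (by
      intro p hp q hq
      obtain ⟨z, hz, hzp, hzq⟩ := hZ.2 _ _ (isOpen_filterNhd p) (isOpen_filterNhd q) hp hq
      obtain ⟨r, hr, hrp, hrq⟩ := z.directed p hzp q hzq
      exact ⟨r, ⟨z, hz, hr⟩, hrp, hrq⟩)
    (by
      rintro p q hpq ⟨z, hz, hp⟩
      exact ⟨z, hz, PFilter.mem_of_le hpq hp⟩)
  refine ⟨x, ?_⟩
  rw [IsGenericPoint, IsScott.closure_singleton]
  refine Set.Subset.antisymm (fun y hy => ?_) fun y hy p hp => ⟨y, hy, hp⟩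
  rw [← hZc.closure_eq, isTopologicalBasis_filterNhd.mem_closure_iff]
  rintro _ ⟨p, rfl⟩ hp
  exact Set.inter_comm Z _ ▸ hy hp

lemma spectralSpace_pFilter_iff : SpectralSpace (PFilter P) ↔
    (∃ t : Finset P, ∀ s, ∃ r ∈ t, s ≤ r) ∧
    ∀ p q : P, ∃ t : Finset P, (∀ r ∈ t, r ≤ p ∧ r ≤ q) ∧
      ∀ s, s ≤ p → s ≤ q → ∃ r ∈ t, s ≤ r := by
  have h₁ : CompactSpace (PFilter P) ↔ ∃ t : Finset P, ∀ s, ∃ r ∈ t, s ≤ r := by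
    rw [← isCompact_univ_iff, isCompact_iff_exists_finset isOpen_univ]
    refine exists_congr fun t => ⟨fun h s => ?_, fun h => ?_⟩
    · simpa [mem_filterNhd] using h.subset (Set.mem_univ (PFilter.principal s))
    · refine (Set.eq_univ_of_forall fun x => ?_).symm
      obtain ⟨s, hs⟩ := x.nonempty
      obtain ⟨r, hr, hsr⟩ := h s
      exact Set.mem_biUnion hr (PFilter.mem_of_le hsr hs)
  have h₂ (p q : P) : IsCompact (filterNhd p ∩ filterNhd q) ↔
      ∃ t : Finset P, (∀ r ∈ t, r ≤ p ∧ r ≤ q) ∧ ∀ s, s ≤ p → s ≤ q → ∃ r ∈ t, s ≤ r := by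
    rw [isCompact_iff_exists_finset ((isOpen_filterNhd p).inter (isOpen_filterNhd q))]
    refine exists_congr fun t => ⟨fun h => ⟨fun r hr => ?_, fun s hp hq => ?_⟩, fun h => ?_⟩
    · have hr' : PFilter.principal r ∈ filterNhd r := le_refl r
      exact h.superset (Set.mem_biUnion hr hr')
    · have hs : PFilter.principal s ∈ filterNhd p ∩ filterNhd q := ⟨hp, hq⟩
      have := h.subset hs
      simpa [mem_filterNhd] using this
    · ext x
      simp only [Set.mem_inter_iff, mem_filterNhd, Set.mem_iUnion, exists_prop]
      constructor
      · rintro ⟨hp, hq⟩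
        obtain ⟨s, hs, hsp, hsq⟩ := x.directed p hp q hq
        obtain ⟨r, hr, hsr⟩ := h.2 s hsp hsq
        exact ⟨r, hr, PFilter.mem_of_le hsr hs⟩
      · rintro ⟨r, hr, hx⟩
        exact ⟨PFilter.mem_of_le (h.1 r hr).1 hx, PFilter.mem_of_le (h.1 r hr).2 hx⟩
  rw [← h₁]
  simp only [← h₂]
  constructor
  · intro h
    exact ⟨h.toCompactSpace, fun p q => (isCompact_filterNhd p).inter_of_isOpen
      (isCompact_filterNhd q) (isOpen_filterNhd p) (isOpen_filterNhd q)⟩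
  · rintro ⟨h, h'⟩
    have := QuasiSeparatedSpace.of_isTopologicalBasis isTopologicalBasis_filterNhd h'
    exact {}

lemma sieve_mem_topologyOfSet_iff {S : Set (PFilter P)} {p : P} {L : Sieve p} :
    L ∈ topologyOfSet S p ↔ ∀ x ∈ S, p ∈ x → ∃ (q : P) (f : q ⟶ p), L f ∧ q ∈ x := by
  change _ ∩ S ⊆ sieveTilde L ↔ _
  simp only [Set.subset_def, sieveTilde, Set.mem_inter_iff, Set.mem_ofPred_eq,
    PFilter.principal_le_iff]
  exact ⟨fun h x hx hp => h x ⟨hp, hx⟩, fun h x hx => h x hx.2 hx.1⟩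

/-- Finitely generated covering subsieves on p correspond to finite subcovers of `filterNhd p ∩ S`.
-/
lemma isOfFiniteType_topologyOfSet_iff {S : Set (PFilter P)} :
    (topologyOfSet S).IsOfFiniteType ↔
      ∀ U : Set (PFilter P), IsOpen U → IsCompact U → IsCompact (Subtype.val ⁻¹' U : Set S) := by
  have key : (∀ U : Set (PFilter P), IsOpen U → IsCompact U →
      IsCompact (Subtype.val ⁻¹' U : Set S)) ↔ ∀ p : P, IsCompact (filterNhd p ∩ S) := by
    simp only [Subtype.isCompact_iff, Subtype.image_preimage_coe, Set.inter_comm S]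
    refine ⟨fun h p => h _ (isOpen_filterNhd p) (isCompact_filterNhd p), fun h U hU hUc => ?_⟩
    obtain ⟨t, rfl⟩ := (isCompact_iff_exists_finset hU).1 hUc
    rw [Set.iUnion₂_inter]
    exact t.isCompact_biUnion fun r _ => h r
  rw [key]
  constructor
  · intro h p
    refine isCompact_of_finite_subcover fun {ι} U hU hpU => ?_
    let L : Sieve p :=
      { arrows := fun q _ => ∃ i, PFilter.principal q ∈ U i
        downward_closed := fun {q r f} ⟨i, hi⟩ g =>
          ⟨i, (filterNhd_subset_iff (hU i)).2 hi (leOfHom g)⟩ }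
    have hL : L ∈ topologyOfSet S p := sieve_mem_topologyOfSet_iff.2 fun x hx hp => by
      obtain ⟨i, hi⟩ := Set.mem_iUnion.1 (hpU ⟨hp, hx⟩)
      obtain ⟨q, hq, hqi⟩ := exists_mem_principal_mem (hU i) hi
      obtain ⟨r, hr, hrp, hrq⟩ := x.directed p hp q hq
      -- The element q need not lie below p; directedness of x replaces it by r, which does.
      exact ⟨r, homOfLE hrp, ⟨i, (filterNhd_subset_iff (hU i)).2 hqi hrq⟩, hr⟩
    obtain ⟨n, Y, f, hf, hle⟩ := h L hL
    choose i hi using fun k => hle _ (Sieve.ofArrows_mk Y f k)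
    classical
    refine ⟨Finset.univ.image i, fun x hx => ?_⟩
    obtain ⟨q, g, hg, hq⟩ := sieve_mem_topologyOfSet_iff.1 hf x hx.2 hx.1
    obtain ⟨k, a, -⟩ := (Sieve.mem_ofArrows_iff _ _ _).1 hg
    simp only [Finset.mem_image, Finset.mem_univ, true_and, Set.iUnion_exists,
      Set.iUnion_iUnion_eq', Set.mem_iUnion]
    exact ⟨k, (filterNhd_subset_iff (hU _)).2 (hi k) (PFilter.mem_of_le (leOfHom a) hq)⟩
  · intro h p L hL
    rw [sieve_mem_topologyOfSet_iff] at hL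
    obtain ⟨t, ht⟩ := (h p).elim_finite_subcover
      (fun q : {q : P // ∃ f : q ⟶ p, L f} => filterNhd q.1) (fun q => isOpen_filterNhd _)
      (fun x hx => by
        obtain ⟨q, f, hf, hq⟩ := hL x hx.2 hx.1
        exact Set.mem_iUnion.2 ⟨⟨q, f, hf⟩, hq⟩)
    refine ⟨t.card, fun k => (t.equivFin.symm k).1.1, fun k => (t.equivFin.symm k).1.2.choose,
      sieve_mem_topologyOfSet_iff.2 fun x hx hp => ?_, ?_⟩
    · obtain ⟨q, hq, hqx⟩ := Set.mem_iUnion₂.1 (ht ⟨hp, hx⟩)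
      refine ⟨_, _, Sieve.ofArrows_mk _ _ (t.equivFin ⟨q, hq⟩), ?_⟩
      simpa [mem_filterNhd] using hqx
    · rintro q g hg
      obtain ⟨k, a, rfl⟩ := (Sieve.mem_ofArrows_iff _ _ _).1 hg
      exact L.downward_closed (t.equivFin.symm k).1.2.choose_spec a

end FilterSpace

theorem mainTheorem2 {P : Type u} [PartialOrder P] :
    (IsCoherentTopos (Pᵒᵖ ⥤ Type u) ↔ SpectralSpace (Order.PFilter P)) ∧
    (SpectralSpace (Order.PFilter P) →
      ∀ S : Set (Order.PFilter P), IsSoberSubspace S →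
        [IsPatch S,
          IsSpectralSubobject S,
          (topologyOfSet S).IsOfFiniteType,
          (GeomMorphism.ofSubspace S).IsCoherentSubtopos].TFAE) := by
  refine ⟨isCoherentTopos_presheaf_iff.trans spectralSpace_pFilter_iff.symm, fun hX S hS => ?_⟩
  tfae_have 1 → 2 := fun h =>
    (isSpectralSubobject_iff hS).2 fun U hU hUc => h.isCompact_preimage hU hUc
  tfae_have 2 → 1 := fun h => h.isPatch
  tfae_have 2 ↔ 3 := (isSpectralSubobject_iff hS).trans isOfFiniteType_topologyOfSet_iff.symm
  tfae_have 2 → 4 := isCoherentSubtopos_of_isSpectralSubobject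
  tfae_have 4 → 2 := fun h => (isSpectralSubobject_iff hS).2 fun U hU hUc =>
    isCompact_trace_of_isCoherentSubtopos h (U := ⟨U, hU⟩) hUc
  tfae_finish
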